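/- For a permutation $\sigma$ of $[n]=\{1,\dots,n\}$ let $\mathrm{inv}\,\sigma$ be the number of pairs $(i,j)$ with $i<j$ and $\sigma(i)>\sigma(j)$, let $\mathrm{exc}\,\sigma$ be the number of $i\in[n]$ with $i<\sigma(i)$, and let $\mathrm{cda}\,\sigma$ be the number of cyclic double ascents of $\sigma$, that is, of $i\in[n]$ with $i<\sigma(i)<\sigma(\sigma(i))$. Let $\mathfrak D_n$ be the set of derangements of $[n]$ (permutations of $[n]$ without fixed points), and let $\mathrm{DE}_{n,k}$ be the set of all $\sigma\in\mathfrak D_n$ with $\mathrm{exc}\,\sigma=k$ and $\mathrm{cda}\,\sigma=0$. Then, for every $n\ge 1$, $$\sum_{\sigma\in\mathfrak D_n} q^{\mathrm{inv}\,\sigma}t^{\mathrm{exc}\,\sigma}=\sum_{0\le k\le n/2}\Bigl(\sum_{\sigma\in \mathrm{DE}_{n,k}} q^{\mathrm{inv}\,\sigma}\Bigr)t^k(1+t)^{n-2k}$$ as an identity of polynomials in $q$ and $t$ with integer coefficients. -/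

import Mathlib

namespace PermStat

/-- The number of excedances: indices `i` with `i < σ i`. -/
def exc {n : ℕ} (σ : Equiv.Perm (Fin n)) : ℕ :=
  (Finset.univ.filter fun i : Fin n => i < σ i).card

/-- The number of inversions: pairs `(i, j)` with `i < j` and `σ i > σ j`. -/
def inv {n : ℕ} (σ : Equiv.Perm (Fin n)) : ℕ :=
  (Finset.univ.filter fun p : Fin n × Fin n => p.1 < p.2 ∧ σ p.2 < σ p.1).card

/-- The number of cyclic double ascents (double excedances):
indices `i` with `i < σ i < σ (σ i)`. -/
def cda {n : ℕ} (σ : Equiv.Perm (Fin n)) : ℕ :=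
  (Finset.univ.filter fun i : Fin n => i < σ i ∧ σ i < σ (σ i)).card

/-- The finite set of derangements (permutations without fixed point) of an `n`-element set. -/
def D (n : ℕ) : Finset (Equiv.Perm (Fin n)) :=
  (derangements (Fin n)).toFinset

/-- The derangements with exactly `k` excedances and no cyclic double ascent. -/
def DE (n k : ℕ) : Finset (Equiv.Perm (Fin n)) :=
  (D n).filter fun σ => exc σ = k ∧ cda σ = 0

end PermStat

/-! Weight each index by its cyclic type: `t` for a valley, `1` for a peak, `a i` for a double
ascent, `b i` for a double descent, `0` for a fixed point. Taking `a = t`, `b = 1` gives the left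
side and `a = 0`, `b = 1 + t` the right side, so it suffices that the inversion generating function
depends only on the sums `a i + b i` (`genFun_eq_of_add_eq`).

One index `j` is treated at a time: with the weights elsewhere kept, double ascents and double
descents at `j` have the same `inv`-distribution (`sum_double_ascent_eq_sum_double_descent`). From a
permutation `σ` fixing `j`, repeatedly exchanging the value `j` with the nearest larger value on its
left gives a chain of `height j σ` double ascents at `j`; each exchange loses one inversion and
keeps all types off `j`. Inverting turns double ascents into double descents, and `σ⁻¹` has the same
`inv` and height. -/

namespace PermStat

open Finset Equiv

variable {n : ℕ}

/-! ### Inversions -/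

/-- Composing with a transposition that realises a cover in the Bruhat order lowers the number of
inversions by exactly one. -/
theorem inv_mul_swap {σ : Perm (Fin n)} {l p : Fin n} (hlp : l < p) (hσ : σ p < σ l)
    (hm : ∀ m, l < m → m < p → σ m < σ p) : inv σ = inv (σ * swap l p) + 1 := by
  unfold inv
  have hmem : (l, p) ∈ univ.filter fun x : Fin n × Fin n => x.1 < x.2 ∧ σ x.2 < σ x.1 := by
    simp [hlp, hσ]
  rw [← card_erase_add_one hmem]
  congr 1
  -- Pairs whose order the transposition would reverse stay put; for these, `hm` shows that being an
  -- inversion is unaffected, except for `(l, p)`.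
  let f : Fin n × Fin n → Fin n × Fin n := fun x =>
    if swap l p x.1 < swap l p x.2 then (swap l p x.1, swap l p x.2) else x
  have hinv : ∀ x : Fin n × Fin n, x.1 < x.2 → f (f x) = x := by
    rintro ⟨a, b⟩ h
    by_cases h' : swap l p a < swap l p b
    · simp [f, h', h]
    · simp [f, h']
  refine card_nbij' f f ?_ ?_ ?_ ?_
  · rintro ⟨a, b⟩ h
    simp only [mem_coe, mem_erase, mem_filter, mem_univ, true_and, ne_eq, Prod.mk.injEq] at h
    simp only [mem_coe, mem_filter, mem_univ, true_and, f]
    simp only [Perm.mul_apply]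
    split_ifs with h'
    · simpa [h'] using h.2.2
    · have := hm a
      have := hm b
      simp only [swap_apply_def] at h' ⊢
      grind
  · rintro ⟨a, b⟩ h
    simp only [mem_coe, mem_filter, mem_univ, true_and] at h
    simp only [Perm.mul_apply] at h
    simp only [mem_coe, mem_erase, mem_filter, mem_univ, true_and, ne_eq, f]
    split_ifs with h'
    · refine ⟨?_, h', h.2⟩
      rw [Prod.mk.injEq]
      simp only [swap_apply_def] at h' ⊢
      grind
    · have := hm a
      have := hm b
      simp only [swap_apply_def] at h' h ⊢
      grind
  · rintro ⟨a, b⟩ h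
    simp only [mem_coe, mem_erase, mem_filter, mem_univ, true_and] at h
    exact hinv _ h.2.1
  · rintro ⟨a, b⟩ h
    simp only [mem_coe, mem_filter, mem_univ, true_and] at h
    exact hinv _ h.1

theorem inv_perm_inv (σ : Perm (Fin n)) : inv σ⁻¹ = inv σ := by
  unfold inv
  refine card_nbij' (fun x => (σ⁻¹ x.2, σ⁻¹ x.1)) (fun x => (σ x.2, σ x.1)) ?_ ?_ ?_ ?_ <;>
    intro x <;> simp +contextual

/-! ### Exchange steps at a value `j` -/

/-- `σ` weakly ascends through the value `j`: both `σ⁻¹ j ≤ j` and `j ≤ σ j`. -/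
def AscThrough (j : Fin n) (σ : Perm (Fin n)) : Prop := σ⁻¹ j ≤ j ∧ j ≤ σ j

/-- `τ` arises from `σ` by exchanging the value `j` with the nearest larger value on its left. -/
def Step (j : Fin n) (σ τ : Perm (Fin n)) : Prop :=
  AscThrough j σ ∧ ∃ l, l < σ⁻¹ j ∧ j < σ l ∧ (∀ m, l < m → m < σ⁻¹ j → σ m < j) ∧
    τ = σ * swap l (σ⁻¹ j)

/-- The number of weak excedance arcs strictly covering `j` from positions up to `j`. -/
def height (j : Fin n) (σ : Perm (Fin n)) : ℕ := (univ.filter fun l => l ≤ j ∧ j < σ l).card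

/-- The number of arcs counted by `height` that start to the right of `σ⁻¹ j`. -/
def level (j : Fin n) (σ : Perm (Fin n)) : ℕ :=
  (univ.filter fun l => σ⁻¹ j < l ∧ l ≤ j ∧ j < σ l).card

variable {j : Fin n} {σ τ : Perm (Fin n)}

theorem level_le_height : level j σ ≤ height j σ :=
  card_le_card fun l => by simp +contextual

theorem level_eq_zero_iff (h : AscThrough j σ) : level j σ = 0 ↔ σ j = j := by
  rw [level, card_eq_zero, filter_eq_empty_iff]
  constructor
  · intro H
    by_contra hj
    refine H (mem_univ j) ⟨lt_of_le_of_ne h.1 fun e => hj ?_, le_rfl, lt_of_le_of_ne h.2 (Ne.symm hj)⟩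
    rw [Perm.inv_eq_iff_eq] at e
    exact e.symm
  · intro hj l _ hl
    have : σ⁻¹ j = j := by rw [Perm.inv_eq_iff_eq, hj]
    rw [this] at hl
    exact absurd hl.1 (not_lt.2 hl.2.1)

namespace Step

theorem inv_eq (h : Step j σ τ) : inv σ = inv τ + 1 := by
  obtain ⟨-, l, hl, hj, hm, rfl⟩ := h
  exact inv_mul_swap hl (by simpa using hj) (by simpa using hm)

theorem ascThrough (h : Step j σ τ) : AscThrough j τ := by
  obtain ⟨⟨h1, h2⟩, l, hl, hj, hm, rfl⟩ := h
  have hp : σ (σ⁻¹ j) = j := by simp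
  constructor
  · simp only [mul_inv_rev, swap_inv, Perm.mul_apply, swap_apply_right]
    exact hl.le.trans h1
  · simp only [Perm.mul_apply, swap_apply_def]
    split_ifs <;> grind

theorem level_eq (h : Step j σ τ) : level j τ = level j σ + 1 := by
  obtain ⟨⟨h1, h2⟩, l, hl, hj, hm, rfl⟩ := h
  have hp : σ (σ⁻¹ j) = j := by simp
  unfold level
  rw [← card_insert_of_notMem (a := σ⁻¹ j) (by simp)]
  congr 1
  ext x
  have := hm x
  simp only [mul_inv_rev, swap_inv, Perm.mul_apply, swap_apply_right, mem_filter, mem_univ,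
    true_and, mem_insert]
  rw [swap_apply_def]
  split_ifs <;> grind

theorem height_eq (h : Step j σ τ) : height j τ = height j σ := by
  obtain ⟨⟨h1, h2⟩, l, hl, hj, hm, rfl⟩ := h
  have hp : σ (σ⁻¹ j) = j := by simp
  unfold height
  refine card_nbij' (swap l (σ⁻¹ j)) (swap l (σ⁻¹ j)) ?_ ?_ ?_ ?_
  · intro x
    simp only [mem_coe, mem_filter, mem_univ, true_and, Perm.mul_apply]
    simp only [swap_apply_def]
    split_ifs <;> grind
  · intro x
    simp only [mem_coe, mem_filter, mem_univ, true_and, Perm.mul_apply]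
    simp only [swap_apply_def]
    split_ifs <;> grind
  · intro x _; simp
  · intro x _; simp

/-- The two positions involved are at most `j` and the two values at least `j`, so away from `j` the
exchange cannot turn an arc around. -/
theorem lt_apply_iff (h : Step j σ τ) {i : Fin n} (hi : i ≠ j) : i < τ i ↔ i < σ i := by
  obtain ⟨⟨h1, h2⟩, l, hl, hj, hm, rfl⟩ := h
  have hp : σ (σ⁻¹ j) = j := by simp
  simp only [Perm.mul_apply, swap_apply_def]
  split_ifs <;> grind

theorem apply_lt_iff (h : Step j σ τ) {i : Fin n} : τ i < i ↔ σ i < i := by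
  obtain ⟨⟨h1, h2⟩, l, hl, hj, hm, rfl⟩ := h
  have hp : σ (σ⁻¹ j) = j := by simp
  simp only [Perm.mul_apply, swap_apply_def]
  split_ifs <;> grind

theorem inv_apply_lt_iff (h : Step j σ τ) {i : Fin n} (hi : i ≠ j) : τ⁻¹ i < i ↔ σ⁻¹ i < i := by
  obtain ⟨⟨h1, h2⟩, l, hl, hj, hm, rfl⟩ := h
  have hp : σ (σ⁻¹ i) = i := by simp
  have hp' : σ (σ⁻¹ j) = j := by simp
  simp only [mul_inv_rev, swap_inv, Perm.mul_apply, swap_apply_def]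
  split_ifs <;> grind

theorem lt_inv_apply_iff (h : Step j σ τ) {i : Fin n} (hi : i ≠ j) : i < τ⁻¹ i ↔ i < σ⁻¹ i := by
  obtain ⟨⟨h1, h2⟩, l, hl, hj, hm, rfl⟩ := h
  have hp : σ (σ⁻¹ i) = i := by simp
  have hp' : σ (σ⁻¹ j) = j := by simp
  simp only [mul_inv_rev, swap_inv, Perm.mul_apply, swap_apply_def]
  split_ifs <;> grind

theorem left_unique {σ' : Perm (Fin n)} (h : Step j σ τ) (h' : Step j σ' τ) : σ = σ' := by
  obtain ⟨⟨h1, h2⟩, l, hl, hj, hm, e⟩ := h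
  obtain ⟨⟨h1', h2'⟩, l', hl', hj', hm', e'⟩ := h'
  have ea : l = τ⁻¹ j := by rw [e]; simp
  have ea' : l' = τ⁻¹ j := by rw [e']; simp
  obtain rfl : l = l' := ea.trans ea'.symm
  have key : ∀ {ρ : Perm (Fin n)}, τ = ρ * swap l (ρ⁻¹ j) → ρ = τ * swap l (ρ⁻¹ j) := by
    intro ρ h
    rw [h, mul_assoc]
    simp
  -- If `ρ'⁻¹ j` lay strictly between `l` and `ρ⁻¹ j`, the entry of `τ` there would be both above
  -- and below `j`.
  have between : ∀ {ρ ρ' : Perm (Fin n)}, τ = ρ * swap l (ρ⁻¹ j) → τ = ρ' * swap l (ρ'⁻¹ j) →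
      l < ρ'⁻¹ j → j < ρ' l → (∀ m, l < m → m < ρ⁻¹ j → ρ m < j) → ¬ ρ'⁻¹ j < ρ⁻¹ j := by
    intro ρ ρ' e e' hl hj hm hlt
    have h3 : τ (ρ'⁻¹ j) = ρ' l := by rw [e']; simp
    have h4 : τ (ρ'⁻¹ j) = ρ (ρ'⁻¹ j) := by
      rw [e, Perm.mul_apply, swap_apply_of_ne_of_ne hl.ne' hlt.ne]
    exact lt_asymm hj (h3 ▸ h4 ▸ hm _ hl hlt)
  have hpp : σ⁻¹ j = σ'⁻¹ j :=
    le_antisymm (not_lt.1 (between e e' hl' hj' hm)) (not_lt.1 (between e' e hl hj hm'))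
  rw [key e, key e', hpp]

theorem right_unique {τ' : Perm (Fin n)} (h : Step j σ τ) (h' : Step j σ τ') : τ = τ' := by
  obtain ⟨-, l, hl, hj, hm, rfl⟩ := h
  obtain ⟨-, l', hl', hj', hm', rfl⟩ := h'
  have := hm l'
  have := hm' l
  rw [show l = l' by grind]

end Step

theorem exists_step (h : AscThrough j σ) (hlt : level j σ < height j σ) : ∃ τ, Step j σ τ := by
  have hp : σ (σ⁻¹ j) = j := by simp
  have hne : (univ.filter fun l => l < σ⁻¹ j ∧ j < σ l).Nonempty := by
    by_contra hne
    rw [not_nonempty_iff_eq_empty, filter_eq_empty_iff] at hne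
    -- With no larger value left of `j`, every arc counted by `height` is counted by `level`.
    refine hlt.not_ge (card_le_card fun l hl => ?_)
    simp only [mem_filter, mem_univ, true_and] at hl ⊢
    refine ⟨?_, hl⟩
    have := hne (mem_univ l)
    grind
  obtain ⟨l, hl, hmax⟩ := exists_max_image _ id hne
  simp only [mem_filter, mem_univ, true_and, id] at hl hmax
  refine ⟨_, h, l, hl.1, hl.2, fun m hm hm' => ?_, rfl⟩
  have := hmax m
  have : σ m ≠ j := fun e => hm'.ne (by simp [← e])
  grind

theorem exists_step_to (h : AscThrough j τ) (hpos : 0 < level j τ) : ∃ σ, Step j σ τ := by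
  have hp : τ (τ⁻¹ j) = j := by simp
  -- The leftmost arc counted by `level` is the one the last exchange must have created.
  obtain ⟨p, hp', hmin⟩ := exists_min_image _ id (card_pos.1 hpos)
  simp only [mem_filter, mem_univ, true_and, id] at hp' hmin
  have e : (τ * swap (τ⁻¹ j) p)⁻¹ j = p := by simp
  refine ⟨τ * swap (τ⁻¹ j) p, ⟨?_, ?_⟩, τ⁻¹ j, ?_, ?_, ?_, ?_⟩
  · rw [e]; exact hp'.2.1
  · have := h.2
    rw [Perm.mul_apply, swap_apply_def]
    split_ifs <;> grind
  · rw [e]; exact hp'.1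
  · simpa using hp'.2.2
  · intro m hm hm'
    rw [e] at hm'
    rw [Perm.mul_apply, swap_apply_of_ne_of_ne hm.ne' hm'.ne]
    have := hmin m
    have : τ m ≠ j := fun e => hm.ne' (by simp [← e])
    grind
  · rw [e, mul_assoc]; simp

/-! ### Summation along chains -/

variable {R : Type*} [CommRing R]

open Classical in
theorem sum_level_eq (j : Fin n) (k : ℕ) (Φ : Perm (Fin n) → R)
    (hΦ : ∀ σ τ, Step j σ τ → Φ τ = Φ σ) :
    ∑ σ with AscThrough j σ ∧ level j σ = k, Φ σ =
      ∑ σ with AscThrough j σ ∧ level j σ = 0, if k ≤ height j σ then Φ σ else 0 := by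
  induction k generalizing Φ with
  | zero => simp
  | succ k ih =>
    have H := ih (fun σ => if k + 1 ≤ height j σ then Φ σ else 0)
      fun σ τ h => by simp only [h.height_eq, hΦ σ τ h]
    have e : ∀ σ, (if k ≤ height j σ then if k + 1 ≤ height j σ then Φ σ else 0 else 0) =
        if k + 1 ≤ height j σ then Φ σ else 0 := fun σ => by split_ifs <;> first | rfl | omega
    simp only [e] at H
    rw [← H, ← sum_filter, filter_filter]
    symm
    have ex : ∀ σ, σ ∈ univ.filter (fun σ => (AscThrough j σ ∧ level j σ = k) ∧
        k + 1 ≤ height j σ) → ∃ τ, Step j σ τ := by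
      intro σ hσ
      simp only [mem_filter, mem_univ, true_and] at hσ
      exact exists_step hσ.1.1 (by omega)
    refine sum_bij (fun σ hσ => (ex σ hσ).choose) ?_ ?_ ?_ ?_
    · intro σ hσ
      have hs := (ex σ hσ).choose_spec
      simp only [mem_filter, mem_univ, true_and] at hσ ⊢
      exact ⟨hs.ascThrough, by rw [hs.level_eq, hσ.1.2]⟩
    · intro σ hσ σ' hσ' heq
      have hs := (ex σ hσ).choose_spec
      have hs' := (ex σ' hσ').choose_spec
      rw [← heq] at hs'
      exact hs.left_unique hs'
    · intro τ hτ
      simp only [mem_filter, mem_univ, true_and] at hτ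
      obtain ⟨σ, hs⟩ := exists_step_to hτ.1 (by omega)
      have hl := hs.level_eq
      have hh := hs.height_eq
      have hle := level_le_height (j := j) (σ := τ)
      have hσ : σ ∈ univ.filter (fun σ => (AscThrough j σ ∧ level j σ = k) ∧
        k + 1 ≤ height j σ) := by
        simp only [mem_filter, mem_univ, true_and]
        exact ⟨⟨hs.1, by omega⟩, by omega⟩
      refine ⟨σ, hσ, ?_⟩
      have hs' := (ex σ hσ).choose_spec
      exact (hs.right_unique hs').symm
    · intro σ hσ
      exact (hΦ _ _ (ex σ hσ).choose_spec).symm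

/-- When `j` is fixed, `height` is `j` minus the number of positions below `j` with values below
`j`, and `σ` matches these with those of `σ⁻¹`. -/
theorem height_inv (j : Fin n) (σ : Perm (Fin n)) (hj : σ j = j) :
    height j σ⁻¹ = height j σ := by
  have key : ∀ ρ : Perm (Fin n), ρ j = j →
      height j ρ + (univ.filter fun l => l < j ∧ ρ l < j).card = j := by
    intro ρ hρ
    have hd : height j ρ = (univ.filter fun l => l < j ∧ ¬ ρ l < j).card := by
      unfold height
      congr 1
      ext l
      have : ρ l = j ↔ l = j := by rw [← ρ.injective.eq_iff (a := l), hρ]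
      simp only [mem_filter, mem_univ, true_and]
      grind
    have h2 : (univ.filter fun l : Fin n => l < j).card = j := by
      rw [← Fin.card_Iio]
      congr 1
      ext; simp
    rw [hd, add_comm, ← filter_filter, ← filter_filter, card_filter_add_card_filter_not, h2]
  have h1 := key σ hj
  have h2 := key σ⁻¹ (by rw [Perm.inv_eq_iff_eq, hj])
  have h3 : (univ.filter fun l => l < j ∧ σ l < j).card =
      (univ.filter fun l => l < j ∧ σ⁻¹ l < j).card := by
    refine card_nbij' σ (σ⁻¹ : Perm (Fin n)) ?_ ?_ ?_ ?_ <;> intro x <;> simp +contextual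
  omega

/-! ### Weighted generating function -/

/-- The weight of the index `i`: a cyclic valley has weight `t`, a cyclic peak `1`, a cyclic double
ascent `a i`, a cyclic double descent `b i` and a fixed point `0`. -/
def weight (t : R) (a b : Fin n → R) (σ : Perm (Fin n)) (i : Fin n) : R :=
  if i < σ i then (if σ⁻¹ i < i then a i else t)
  else if σ i < i then (if i < σ⁻¹ i then b i else 1) else 0

/-- The inversion generating function of permutations, weighted by `weight`. -/
def genFun (q t : R) (a b : Fin n → R) : R :=
  ∑ σ : Perm (Fin n), q ^ inv σ * ∏ i, weight t a b σ i

theorem Step.weight_eq (h : Step j σ τ) (t : R) (a b : Fin n → R) {i : Fin n} (hi : i ≠ j) :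
    weight t a b τ i = weight t a b σ i := by
  simp only [weight, h.lt_apply_iff hi, h.apply_lt_iff, h.inv_apply_lt_iff hi,
    h.lt_inv_apply_iff hi]

theorem Step.weight_inv_eq (h : Step j σ τ) (t : R) (a b : Fin n → R) {i : Fin n} (hi : i ≠ j) :
    weight t a b τ⁻¹ i = weight t a b σ⁻¹ i := by
  simp only [weight, h.lt_apply_iff hi, h.apply_lt_iff, h.inv_apply_lt_iff hi,
    h.lt_inv_apply_iff hi, inv_inv]

/-- The double ascents at `j` fall into chains under `Step`, each starting at a permutation that
fixes `j`. -/
theorem sum_double_ascent (q : R) (j : Fin n) (F : Perm (Fin n) → R)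
    (hF : ∀ σ τ, Step j σ τ → F τ = F σ) :
    ∑ σ with σ⁻¹ j < j ∧ j < σ j, q ^ inv σ * F σ =
      ∑ k ∈ range n, ∑ σ with σ j = j,
        if k + 1 ≤ height j σ then q ^ (inv σ - (k + 1)) * F σ else 0 := by
  classical
  have hiff : ∀ σ : Perm (Fin n), σ⁻¹ j < j ∧ j < σ j ↔ AscThrough j σ ∧ level j σ ≠ 0 := by
    intro σ
    constructor
    · intro h
      refine ⟨⟨h.1.le, h.2.le⟩, ?_⟩
      rw [Ne, level_eq_zero_iff ⟨h.1.le, h.2.le⟩]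
      exact h.2.ne'
    · rintro ⟨h, h'⟩
      rw [Ne, level_eq_zero_iff h] at h'
      exact ⟨lt_of_le_of_ne h.1 fun e => h' (Perm.inv_eq_iff_eq.1 e).symm,
        lt_of_le_of_ne h.2 (Ne.symm h')⟩
  have hfix : ∀ σ : Perm (Fin n), σ j = j ↔ AscThrough j σ ∧ level j σ = 0 := by
    intro σ
    constructor
    · intro h
      have : AscThrough j σ := ⟨(Perm.inv_eq_iff_eq.2 h.symm).le, h.ge⟩
      exact ⟨this, (level_eq_zero_iff this).2 h⟩
    · rintro ⟨h, h'⟩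
      exact (level_eq_zero_iff h).1 h'
  simp only [hiff, hfix]
  rw [← sum_fiberwise_of_maps_to (s := univ.filter fun σ => AscThrough j σ ∧ level j σ ≠ 0)
    (t := range n) (g := fun σ => level j σ - 1)]
  · refine sum_congr rfl fun k _ => ?_
    -- `inv + level` is constant along a chain, so this exponent is `inv σ` at level `k + 1` and
    -- `inv σ - (k + 1)` at the start.
    have H := sum_level_eq j (k + 1) (fun σ => q ^ (inv σ + level j σ - (k + 1)) * F σ)
      fun σ τ h => by
        simp only [hF σ τ h, h.level_eq, h.inv_eq]
        congr 2
        omega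
    rw [filter_filter]
    calc _ = ∑ σ with AscThrough j σ ∧ level j σ = k + 1,
          q ^ (inv σ + level j σ - (k + 1)) * F σ := by
          refine sum_congr ?_ ?_
          · ext σ
            simp only [mem_filter, mem_univ, true_and, and_assoc]
            refine and_congr_right fun _ => ?_
            omega
          · intro σ hσ
            simp only [mem_filter, mem_univ, true_and] at hσ
            rw [hσ.2, Nat.add_sub_cancel]
      _ = _ := by
          rw [H]
          refine sum_congr rfl fun σ hσ => ?_
          simp only [mem_filter, mem_univ, true_and] at hσ
          simp only [hσ.2, Nat.add_zero]
  · intro σ hσ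
    simp only [mem_filter, mem_univ, true_and, ne_eq] at hσ
    have : level j σ ≤ n := (card_le_univ _).trans_eq (Fintype.card_fin n)
    rw [mem_range]
    omega

theorem sum_double_ascent_eq_sum_double_descent (q t : R) (a b : Fin n → R) (j : Fin n) :
    ∑ σ with σ⁻¹ j < j ∧ j < σ j, q ^ inv σ * ∏ i ∈ univ.erase j, weight t a b σ i =
      ∑ σ with j < σ⁻¹ j ∧ σ j < j, q ^ inv σ * ∏ i ∈ univ.erase j, weight t a b σ i := by
  have hinv : ∀ (f : Perm (Fin n) → R) (P : Perm (Fin n) → Prop) [DecidablePred P],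
      ∑ σ with P σ, f σ = ∑ σ with P σ⁻¹, f σ⁻¹ := by
    intro f P _
    rw [sum_filter, sum_filter]
    exact (Equiv.sum_comp (Equiv.inv (Perm (Fin n))) fun σ => if P σ then f σ else 0).symm
  rw [hinv _ fun σ => j < σ⁻¹ j ∧ σ j < j]
  simp only [inv_inv, inv_perm_inv]
  rw [sum_double_ascent q j (fun σ => ∏ i ∈ univ.erase j, weight t a b σ i)
    fun σ τ h => prod_congr rfl fun i hi => h.weight_eq t a b (ne_of_mem_erase hi)]
  simp only [and_comm (a := j < _)]
  rw [sum_double_ascent q j (fun σ => ∏ i ∈ univ.erase j, weight t a b σ⁻¹ i)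
    fun σ τ h => prod_congr rfl fun i hi => h.weight_inv_eq t a b (ne_of_mem_erase hi)]
  refine sum_congr rfl fun k _ => ?_
  rw [hinv]
  refine sum_congr ?_ fun σ hσ => ?_
  · ext σ
    rw [mem_filter, mem_filter, Perm.inv_eq_iff_eq, eq_comm]
  · rw [height_inv j σ (mem_filter.1 hσ).2, inv_perm_inv]

/-- The generating function only depends on the sums `a j + b j`. -/
theorem genFun_eq_of_add_eq_at (q t : R) {a b a' b' : Fin n → R} (j : Fin n)
    (ha : ∀ i, i ≠ j → a i = a' i) (hb : ∀ i, i ≠ j → b i = b' i)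
    (hj : a j + b j = a' j + b' j) : genFun q t a b = genFun q t a' b' := by
  -- Valleys and peaks at `j` make the first sum; double ascents and descents share one sum, with
  -- coefficient `c j + d j`.
  have key : ∀ c d : Fin n → R, genFun q t c d =
      ∑ σ : Perm (Fin n), q ^ inv σ * ((if j < σ j then (if σ⁻¹ j < j then 0 else t)
        else if σ j < j then (if j < σ⁻¹ j then 0 else 1) else 0) *
          ∏ i ∈ univ.erase j, weight t c d σ i) +
      (c j + d j) * ∑ σ with σ⁻¹ j < j ∧ j < σ j,
        q ^ inv σ * ∏ i ∈ univ.erase j, weight t c d σ i := by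
    intro c d
    rw [add_mul, sum_double_ascent_eq_sum_double_descent q t c d j |> congrArg (d j * ·),
      sum_filter, sum_filter, mul_sum, mul_sum, ← sum_add_distrib, ← sum_add_distrib]
    refine sum_congr rfl fun σ _ => ?_
    rw [← mul_prod_erase univ _ (mem_univ j)]
    generalize ∏ i ∈ univ.erase j, weight t c d σ i = P
    unfold weight
    split_ifs <;> first | ring1 | (exfalso; grind)
  have hw : ∀ σ : Perm (Fin n), ∏ i ∈ univ.erase j, weight t a b σ i =
      ∏ i ∈ univ.erase j, weight t a' b' σ i := fun σ => prod_congr rfl fun i hi => by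
    simp only [weight, ha i (ne_of_mem_erase hi), hb i (ne_of_mem_erase hi)]
  rw [key, key, hj]
  simp only [hw]

theorem genFun_eq_of_add_eq (q t : R) {a b a' b' : Fin n → R} (h : ∀ i, a i + b i = a' i + b' i) :
    genFun q t a b = genFun q t a' b' := by
  have key : ∀ s : Finset (Fin n), genFun q t a b =
      genFun q t (fun i => if i ∈ s then a' i else a i) (fun i => if i ∈ s then b' i else b i) := by
    intro s
    induction s using Finset.induction_on with
    | empty => simp
    | insert j s hjs ih =>
      rw [ih]
      refine genFun_eq_of_add_eq_at q t j ?_ ?_ ?_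
      · intro i hi; simp [hi]
      · intro i hi; simp [hi]
      · simp [hjs, h j]
  simpa using key univ

/-! ### The two specialisations -/

theorem mem_D : σ ∈ D n ↔ ∀ i, σ i ≠ i := by
  rw [D, Set.mem_toFinset]
  rfl

theorem genFun_eq_sum_exc (q t : R) :
    genFun q t (fun _ : Fin n => t) (fun _ => 1) = ∑ σ ∈ D n, q ^ inv σ * t ^ exc σ := by
  have hD : D n = univ.filter fun σ => ∀ i, σ i ≠ i := by ext; simp [mem_D]
  rw [hD, sum_filter]
  refine sum_congr rfl fun σ _ => ?_
  split_ifs with h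
  · congr 1
    rw [exc, ← prod_const, prod_filter]
    refine prod_congr rfl fun i _ => ?_
    have := h i
    simp only [weight, ite_self]
    split_ifs <;> first | rfl | (exfalso; grind)
  · push Not at h
    obtain ⟨i, hi⟩ := h
    rw [prod_eq_zero (mem_univ i) (by simp [weight, hi]), mul_zero]

theorem cda_eq_zero_iff : cda σ = 0 ↔ ∀ i, ¬ (σ⁻¹ i < i ∧ i < σ i) := by
  rw [cda, card_eq_zero, filter_eq_empty_iff]
  refine ⟨fun h i hi => h (mem_univ (σ⁻¹ i)) (by simpa using hi), fun h i _ hi => ?_⟩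
  exact h (σ i) (by simpa using hi)

/-- There are as many excedance values as excedances. -/
theorem card_inv_apply_lt (σ : Perm (Fin n)) :
    (univ.filter fun i => σ⁻¹ i < i).card = exc σ := by
  unfold exc
  refine card_nbij' (σ⁻¹ : Perm (Fin n)) σ ?_ ?_ ?_ ?_ <;> intro x <;> simp

/-- Without double ascents, excedance positions and excedance values are disjoint sets of size `exc
σ`; in a derangement all other indices are double descents. -/
theorem card_double_descent (h : ∀ i, σ i ≠ i) (hc : cda σ = 0) :
    2 * exc σ + (univ.filter fun i => σ i < i ∧ i < σ⁻¹ i).card = n := by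
  rw [cda_eq_zero_iff] at hc
  have h' : ∀ i, σ⁻¹ i ≠ i := fun i e => h i (Perm.inv_eq_iff_eq.1 e).symm
  have h1 : (univ.filter fun i => σ i < i ∧ i < σ⁻¹ i) =
      univ.filter fun i => ¬ (i < σ i ∨ σ⁻¹ i < i) := by
    ext i
    have := h i
    have := h' i
    simp only [mem_filter, mem_univ, true_and]
    grind
  have h2 : (univ.filter fun i => i < σ i ∨ σ⁻¹ i < i).card = 2 * exc σ := by
    rw [filter_or, card_union_of_disjoint, card_inv_apply_lt, exc, two_mul]
    rw [disjoint_filter]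
    exact fun i _ h1 h2 => hc i ⟨h2, h1⟩
  rw [h1, ← h2, card_filter_add_card_filter_not, card_univ, Fintype.card_fin]

theorem genFun_eq_sum_cda_eq_zero (q t : R) :
    genFun q t (fun _ : Fin n => 0) (fun _ => 1 + t) =
      ∑ σ ∈ (D n).filter (fun σ => cda σ = 0),
        q ^ inv σ * (t ^ exc σ * (1 + t) ^ (n - 2 * exc σ)) := by
  have hD : (D n).filter (fun σ => cda σ = 0) =
      univ.filter fun σ => (∀ i, σ i ≠ i) ∧ cda σ = 0 := by ext; simp [mem_D]
  rw [hD, sum_filter]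
  refine sum_congr rfl fun σ _ => ?_
  split_ifs with h
  · congr 1
    have hn : n - 2 * exc σ = (univ.filter fun i => σ i < i ∧ i < σ⁻¹ i).card := by
      have := card_double_descent h.1 h.2
      omega
    rw [hn, exc, ← prod_const, ← prod_const, prod_filter, prod_filter, ← prod_mul_distrib]
    refine prod_congr rfl fun i _ => ?_
    have := h.1 i
    have := cda_eq_zero_iff.1 h.2 i
    simp only [weight]
    split_ifs <;> first | ring1 | (exfalso; grind)
  · rw [not_and_or, cda_eq_zero_iff] at h
    push Not at h
    obtain ⟨i, hi⟩ | ⟨i, hi⟩ := h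
    · rw [prod_eq_zero (mem_univ i) (by simp [weight, hi]), mul_zero]
    · rw [prod_eq_zero (mem_univ i) (by rw [weight, if_pos hi.2, if_pos hi.1]), mul_zero]

end PermStat

theorem theorem2 {R : Type*} [CommRing R] (q t : R) (n : ℕ) (hn : 1 ≤ n) :
    ∑ σ ∈ PermStat.D n, q ^ PermStat.inv σ * t ^ PermStat.exc σ =
      ∑ k ∈ Finset.range (n / 2 + 1),
        (∑ σ ∈ PermStat.DE n k, q ^ PermStat.inv σ) * t ^ k * (1 + t) ^ (n - 2 * k) := by
  rw [← PermStat.genFun_eq_sum_exc,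
    PermStat.genFun_eq_of_add_eq q t (a' := fun _ => 0) (b' := fun _ => 1 + t) fun i => by ring,
    PermStat.genFun_eq_sum_cda_eq_zero,
    ← Finset.sum_fiberwise_of_maps_to (t := Finset.range (n / 2 + 1)) (g := PermStat.exc)]
  · refine Finset.sum_congr rfl fun k _ => ?_
    have : PermStat.DE n k = ((PermStat.D n).filter fun σ => PermStat.cda σ = 0).filter
        fun σ => PermStat.exc σ = k := by
      ext; simp [PermStat.DE, and_assoc, and_comm]
    rw [this, mul_assoc, Finset.sum_mul]
    refine Finset.sum_congr rfl fun σ hσ => ?_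
    rw [(Finset.mem_filter.1 hσ).2]
  · intro σ hσ
    rw [Finset.mem_filter, PermStat.mem_D] at hσ
    have := PermStat.card_double_descent hσ.1 hσ.2
    rw [Finset.mem_range]
    omega
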